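/- **Setting.** A quantum game has a finite set of players $i$, each with a Hilbert space $\mathbb{C}^{d_i}$, $d_i\ge 1$; a finite set $\Omega$ of outcomes with positive semidefinite operators $P_\omega$ on $\bigotimes_i\mathbb{C}^{d_i}$ such that $\sum_\omega P_\omega=I$; and payoff observables $U_i:\Omega\to\mathbb{R}$. The density matrices of player $i$ are $\mathcal{X}_i=\{X\in\mathbb{C}^{d_i\times d_i} : X\succeq 0,\ \operatorname{tr}X=1\}$, and the expected payoff of player $i$ at $X=(X_j)_j$ is $$u_i(X)=\sum_{\omega\in\Omega}U_i(\omega)\,\operatorname{tr}\Big(P_\omega\bigotimes_j X_j\Big),$$ which extends multilinearly to Hermitian $X_j$. Let $V_i(X)$ be the gradient of $u_i$ in the variable $X_i$ with respect to the inner product $\langle A,B\rangle=\operatorname{tr}(AB)$ on Hermitian matrices. Each player has a regularizer $h_i(X_i)=\operatorname{tr}\theta_i(X_i)$, where $\theta_i:[0,1]\to\mathbb{R}$ is continuous, twice differentiable on $(0,1]$ with $\inf_{(0,1]}\theta_i''>0$, and $\theta_i(0)=0$. For Hermitian $Y_i$ put $Q_i(Y_i)=\operatorname{argmax}_{X_i\in\mathcal{X}_i}\{\operatorname{tr}(Y_iX_i)-h_i(X_i)\}$.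 Let $\mathcal{Y}=\prod_i\{Y_i\in\mathbb{C}^{d_i\times d_i} : Y_i \text{ Hermitian}\}$ and $\mathcal{Z}=\{Z\in\mathcal{Y} : \operatorname{tr}Z_i=0\text{ for all }i\}$, each with its Lebesgue measure $\operatorname{vol}$, and let $\Pi:\mathcal{Y}\to\mathcal{Z}$, $\Pi(Y)_i=Y_i-\tfrac1{d_i}\operatorname{tr}(Y_i)I$. Consider the FTQL dynamics on $\mathcal{Y}$, $$\dot Y_i=V_i(X),\qquad X_j=Q_j(Y_j)\ \text{ for all } j,\tag{FTQL}$$ and the induced dynamics on the traceless quotient $\mathcal{Z}$, $$\dot Z_i=V_i(X)-\tfrac1{d_i}\operatorname{tr}(V_i(X))\,I,\qquad X_j=Q_j(Z_j)\ \text{ for all } j.\tag{FTQL$_{\mathcal Z}$}$$ **Proposition.** For every quantum game and all such regularizers, (FTQL) and (FTQL$_{\mathcal Z}$) are well-posed: there are unique continuous flows $\psi:\mathbb{R}\times\mathcal{Y}\to\mathcal{Y}$ and $\zeta:\mathbb{R}\times\mathcal{Z}\to\mathcal{Z}$ whose orbits are exactly the solutions on $\mathbb{R}$ of the respective system, and $\zeta_t\circ\Pi=\Pi\circ\psi_t$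 for all $t\in\mathbb{R}$. Moreover, both flows preserve volume: 1. if $U\subseteq\mathcal{Y}$ is open, then $\operatorname{vol}(\psi_t(U))=\operatorname{vol}(U)$ for all $t\ge 0$; 2. if $W\subseteq\mathcal{Z}$ is open, then $\operatorname{vol}(\zeta_t(W))=\operatorname{vol}(W)$ for all $t\ge 0$. -/

import Mathlib

open scoped ComplexOrder

namespace QuantumFTQL

/-! ## Hermitian matrices as a real Euclidean space -/

/-- The real vector space of Hermitian `n × n` complex matrices. -/
def Herm (n : ℕ) : Type :=
  selfAdjoint.submodule ℝ (Matrix (Fin n) (Fin n) ℂ)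

namespace Herm

noncomputable instance (n : ℕ) : AddCommGroup (Herm n) :=
  inferInstanceAs (AddCommGroup (selfAdjoint.submodule ℝ (Matrix (Fin n) (Fin n) ℂ)))

noncomputable instance (n : ℕ) : Module ℝ (Herm n) :=
  inferInstanceAs (Module ℝ (selfAdjoint.submodule ℝ (Matrix (Fin n) (Fin n) ℂ)))

instance (n : ℕ) : Module.Finite ℝ (Herm n) :=
  inferInstanceAs (Module.Finite ℝ (selfAdjoint.submodule ℝ (Matrix (Fin n) (Fin n) ℂ)))

/-- The underlying matrix. -/
def mat {n : ℕ} (A : Herm n) : Matrix (Fin n) (Fin n) ℂ := A.1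

theorem isHermitian {n : ℕ} (A : Herm n) : A.mat.IsHermitian := A.2

/-- A Hermitian matrix, seen as an element of `Herm n`. -/
def ofIsHermitian {n : ℕ} (A : Matrix (Fin n) (Fin n) ℂ) (hA : A.IsHermitian) : Herm n := ⟨A, hA⟩

@[simp] theorem mat_ofIsHermitian {n : ℕ} (A : Matrix (Fin n) (Fin n) ℂ) (hA : A.IsHermitian) :
    (ofIsHermitian A hA).mat = A := rfl

@[simp] theorem mat_add {n : ℕ} (A B : Herm n) : (A + B).mat = A.mat + B.mat := rfl

@[simp] theorem mat_smul {n : ℕ} (r : ℝ) (A : Herm n) : (r • A).mat = r • A.mat := rfl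

@[simp] theorem mat_sub {n : ℕ} (A B : Herm n) : (A - B).mat = A.mat - B.mat := rfl

@[simp] theorem mat_zero {n : ℕ} : (0 : Herm n).mat = 0 := rfl

@[ext] theorem ext {n : ℕ} {A B : Herm n} (h : A.mat = B.mat) : A = B := Subtype.ext h

/-- The trace pairing `tr (A B)` of two Hermitian matrices (a real number). -/
def pairing {n : ℕ} (A B : Herm n) : ℝ := (A.mat * B.mat).trace.re

/-- The (real) trace of a Hermitian matrix. -/
def tr {n : ℕ} (A : Herm n) : ℝ := A.mat.trace.re

theorem pairing_self {n : ℕ} (A : Herm n) :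
    pairing A A = ∑ i, ∑ j, Complex.normSq (A.mat i j) := by
  simp only [pairing, Matrix.trace, Matrix.diag, Matrix.mul_apply, Complex.re_sum]
  refine Finset.sum_congr rfl fun i _ => Finset.sum_congr rfl fun j _ => ?_
  rw [← A.isHermitian.apply j i, Complex.star_def, Complex.mul_conj, Complex.ofReal_re]

/-- The trace (Frobenius) inner product `⟪A, B⟫ = tr (A B)`. -/
noncomputable abbrev innerCore (n : ℕ) : InnerProductSpace.Core ℝ (Herm n) where
  inner := pairing
  conj_inner_symm A B := by simp [pairing, Matrix.trace_mul_comm A.mat]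
  re_inner_nonneg A := by
    change 0 ≤ pairing A A
    rw [pairing_self]
    exact Finset.sum_nonneg fun i _ => Finset.sum_nonneg fun j _ => Complex.normSq_nonneg _
  add_left A B C := by simp [pairing, add_mul]
  smul_left A B r := by simp [pairing]
  definite A h := by
    change pairing A A = 0 at h
    rw [pairing_self] at h
    ext i j
    have h1 := (Finset.sum_eq_zero_iff_of_nonneg fun i _ =>
      Finset.sum_nonneg fun j _ => Complex.normSq_nonneg (A.mat i j)).1 h i (Finset.mem_univ i)
    have h2 := (Finset.sum_eq_zero_iff_of_nonneg fun j _ =>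
      Complex.normSq_nonneg (A.mat i j)).1 h1 j (Finset.mem_univ j)
    simpa using h2

noncomputable instance (n : ℕ) : NormedAddCommGroup (Herm n) :=
  (innerCore n).toNormedAddCommGroup

noncomputable instance (n : ℕ) : InnerProductSpace ℝ (Herm n) :=
  InnerProductSpace.ofCore (innerCore n).toCore

theorem inner_def {n : ℕ} (A B : Herm n) : inner ℝ A B = pairing A B := rfl

instance (n : ℕ) : CompleteSpace (Herm n) := FiniteDimensional.complete ℝ (Herm n)

/-- Lebesgue measure on `Herm n` is the `volume` that Mathlib attaches to a finite-dimensional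
real inner product space with its Borel σ-algebra. -/
noncomputable instance (n : ℕ) : MeasurableSpace (Herm n) := borel _

instance (n : ℕ) : BorelSpace (Herm n) := ⟨rfl⟩

end Herm

/-! ## The traceless quotient of `Herm n` -/

/-- The linear subspace of traceless Hermitian matrices. -/
def tracelessSubmodule (n : ℕ) : Submodule ℝ (Herm n) where
  carrier := {A | A.tr = 0}
  add_mem' {A B} hA hB := by
    simp only [Set.mem_ofPred_eq, Herm.tr, Herm.mat_add, Matrix.trace_add, Complex.add_re] at *
    rw [hA, hB, add_zero]
  zero_mem' := by simp [Herm.tr]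
  smul_mem' r A hA := by
    simp only [Set.mem_ofPred_eq, Herm.tr, Herm.mat_smul, Matrix.trace_smul, Complex.smul_re] at *
    rw [hA, smul_zero]

/-- The space of traceless Hermitian matrices, as a Euclidean space of its own (a separate type,
so that `volume` on it is its own Lebesgue measure and not the restriction of the Lebesgue
measure of `Herm n`, for which it is a null set). -/
def Traceless (n : ℕ) : Type := tracelessSubmodule n

namespace Traceless

noncomputable instance (n : ℕ) : NormedAddCommGroup (Traceless n) :=
  inferInstanceAs (NormedAddCommGroup (tracelessSubmodule n))

noncomputable instance (n : ℕ) : InnerProductSpace ℝ (Traceless n) :=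
  inferInstanceAs (InnerProductSpace ℝ (tracelessSubmodule n))

instance (n : ℕ) : Module.Finite ℝ (Traceless n) :=
  inferInstanceAs (Module.Finite ℝ (tracelessSubmodule n))

noncomputable instance (n : ℕ) : MeasurableSpace (Traceless n) := borel _

instance (n : ℕ) : BorelSpace (Traceless n) := ⟨rfl⟩

/-- A traceless Hermitian matrix, seen as a Hermitian matrix. -/
def toHerm {n : ℕ} (A : Traceless n) : Herm n := A.1

end Traceless

theorem isHermitian_sub_trace {n : ℕ} (A : Herm n) :
    (A.mat - (A.tr / n) • (1 : Matrix (Fin n) (Fin n) ℂ)).IsHermitian := by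
  refine A.isHermitian.sub ?_
  simp [Matrix.IsHermitian, Matrix.conjTranspose_smul]

/-- The projection `Y ↦ Y - (1/n) tr(Y) I` onto traceless matrices. -/
noncomputable def removeTrace {n : ℕ} (A : Herm n) : Traceless n :=
  ⟨Herm.ofIsHermitian (A.mat - (A.tr / n) • (1 : Matrix (Fin n) (Fin n) ℂ))
    (isHermitian_sub_trace A), by
    change Complex.re (Matrix.trace _) = 0
    rcases Nat.eq_zero_or_pos n with rfl | hn
    · simp [Matrix.trace]
    · have : (n : ℝ) ≠ 0 := by positivity
      simp only [Herm.mat_ofIsHermitian, Matrix.trace_sub, Matrix.trace_smul, Matrix.trace_one,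
        Fintype.card_fin, Complex.sub_re, Complex.smul_re, Complex.natCast_re, smul_eq_mul,
        Herm.tr]
      field_simp
      simp⟩

/-! ## Quantum games -/

section Game

variable {ι : Type*} [Fintype ι] [DecidableEq ι] {d : ι → ℕ} {Ω : Type*} [Fintype Ω]

/-- A quantum game with (finite) player set `ι`, in which player `i` has the Hilbert space
`ℂ^(d i)`, and with finite set `Ω` of measurement outcomes. The tensor product of the players'
Hilbert spaces is written in the product basis, i.e. it has coordinates indexed by
`∀ i, Fin (d i)`. The data are a POVM on the tensor product and the payoff observables. -/
structure QuantumGame {ι : Type*} [Fintype ι] [DecidableEq ι] (d : ι → ℕ) (Ω : Type*) [Fintype Ω] where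
  /-- The measurement operator attached to each outcome. -/
  povm : Ω → Matrix (∀ i, Fin (d i)) (∀ i, Fin (d i)) ℂ
  povm_posSemidef : ∀ ω, (povm ω).PosSemidef
  sum_povm : ∑ ω, povm ω = 1
  /-- The payoff to each player of each outcome. -/
  observable : ι → Ω → ℝ

/-- The product ket `ψ₁ ⊗ ⋯ ⊗ ψ_N`. -/
noncomputable def productKet (ψ : ∀ i, EuclideanSpace ℂ (Fin (d i))) : (∀ i, Fin (d i)) → ℂ :=
  fun k => ∏ i, ψ i (k i)

/-- The tensor (Kronecker) product `X₁ ⊗ ⋯ ⊗ X_N` of Hermitian matrices. -/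
noncomputable def productMatrix (X : ∀ i, Herm (d i)) :
    Matrix (∀ i, Fin (d i)) (∀ i, Fin (d i)) ℂ :=
  Matrix.of fun k l => ∏ i, (X i).mat (k i) (l i)

/-- Probability of the outcome `ω` at a profile of pure states (unit vectors). -/
noncomputable def outcomeProb (G : QuantumGame d Ω) (ψ : ∀ i, EuclideanSpace ℂ (Fin (d i)))
    (ω : Ω) : ℝ :=
  (star (productKet ψ) ⬝ᵥ (G.povm ω).mulVec (productKet ψ)).re

/-- Expected payoff of player `i` at a profile of pure states. -/
noncomputable def purePayoff (G : QuantumGame d Ω) (i : ι)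
    (ψ : ∀ i, EuclideanSpace ℂ (Fin (d i))) : ℝ :=
  ∑ ω, outcomeProb G ψ ω * G.observable i ω

/-- Expected payoff of player `i` at a profile of mixed states (Born's rule), extended to all
profiles of Hermitian matrices by multilinearity. `mixedPayoff_eq_sum` shows that it is the
multilinear average of the pure payoffs, for every way to write the density matrices as mixtures
of pure states. -/
noncomputable def mixedPayoff (G : QuantumGame d Ω) (i : ι) (X : ∀ i, Herm (d i)) : ℝ :=
  ∑ ω, (G.povm ω * productMatrix X).trace.re * G.observable i ω

theorem mixedPayoff_eq_sum (G : QuantumGame d Ω) (i : ι) (X : ∀ i, Herm (d i))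
    {A : ι → Type*} [∀ j, Fintype (A j)] (x : ∀ j, A j → ℝ)
    (ψ : ∀ j, A j → EuclideanSpace ℂ (Fin (d j)))
    (hX : ∀ j, (X j).mat = ∑ a, x j a • Matrix.vecMulVec (ψ j a) (star (ψ j a).ofLp)) :
    mixedPayoff G i X =
      ∑ a : ∀ j, A j, (∏ j, x j (a j)) * purePayoff G i (fun j => ψ j (a j)) := by
  have key : productMatrix X = ∑ a : ∀ j, A j, (∏ j, x j (a j)) •
      Matrix.vecMulVec (productKet fun j => ψ j (a j)) (star (productKet fun j => ψ j (a j))) := by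
    ext k l
    simp only [productMatrix, Matrix.of_apply, hX, Matrix.sum_apply, Matrix.smul_apply,
      Matrix.vecMulVec_apply, productKet, Pi.star_apply, star_prod, Finset.prod_univ_sum,
      Fintype.piFinset_univ]
    refine Finset.sum_congr rfl fun a _ => ?_
    simp [Finset.prod_mul_distrib]
  simp only [mixedPayoff, purePayoff, outcomeProb, key, Finset.mul_sum, Matrix.trace_sum,
    Complex.re_sum, Finset.sum_mul]
  rw [Finset.sum_comm]
  refine Finset.sum_congr rfl fun a _ => Finset.sum_congr rfl fun ω _ => ?_
  rw [Matrix.mul_smul, Matrix.trace_smul, Matrix.mul_vecMulVec, Matrix.trace_vecMulVec,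
    dotProduct_comm, Complex.smul_re, smul_eq_mul, mul_assoc]

/-- The individual payoff gradient of player `i`: the gradient, with respect to the trace inner
product, of the payoff of player `i` in the player's own matrix variable. -/
noncomputable def payoffGradient (G : QuantumGame d Ω) (X : ∀ i, Herm (d i))
    (i : ι) : Herm (d i) :=
  gradient (fun H : Herm (d i) => mixedPayoff G i (Function.update X i H)) (X i)

end Game

/-! ## Regularized best responses -/

/-- Density matrices: positive-semidefinite matrices with unit trace. -/
def spectraplex (n : ℕ) : Set (Herm n) := {X | X.mat.PosSemidef ∧ X.mat.trace = 1}

/-- Kernels `θ : [0,1] → ℝ` of regularizers: continuous on `[0,1]`, twice differentiable on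
`(0,1]` with `inf θ'' > 0` there, and normalized by `θ 0 = 0`. Only the values of the function
`θ : ℝ → ℝ` on `[0,1]` matter. -/
structure IsRegularizerKernel (θ : ℝ → ℝ) : Prop where
  continuousOn : ContinuousOn θ (Set.Icc 0 1)
  differentiableOn : DifferentiableOn ℝ θ (Set.Ioc 0 1)
  differentiableOn_deriv : DifferentiableOn ℝ (derivWithin θ (Set.Ioc 0 1)) (Set.Ioc 0 1)
  second_deriv_lower_bound : ∃ c : ℝ, 0 < c ∧
    ∀ x ∈ Set.Ioc (0 : ℝ) 1, c ≤ derivWithin (derivWithin θ (Set.Ioc 0 1)) (Set.Ioc 0 1) x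
  map_zero : θ 0 = 0

/-- The regularizer `h(X) = tr θ(X)`, with `θ(X) = ∑ₖ θ(λₖ) uₖ uₖ†` defined by functional
calculus. -/
noncomputable def regularizer {n : ℕ} (θ : ℝ → ℝ) (X : Herm n) : ℝ :=
  (X.isHermitian.cfc θ).trace.re

/-- The regularized best responses to `Y`: the maximizers of `tr(Y X) - h(X)` over all density
matrices `X`. -/
def regularizedBestResponse {n : ℕ} (θ : ℝ → ℝ) (Y : Herm n) : Set (Herm n) :=
  {X | X ∈ spectraplex n ∧
    ∀ X' ∈ spectraplex n, Y.pairing X' - regularizer θ X' ≤ Y.pairing X - regularizer θ X}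

/-! ## The dynamics -/

section Dynamics

variable {ι : Type*} [Fintype ι] [DecidableEq ι] {d : ι → ℕ} {Ω : Type*} [Fintype Ω]

/-- `Y` is a solution on `ℝ` of the FTQL dynamics
`dYᵢ/dt = Vᵢ(X(t))`, `Xᵢ(t) = Qᵢ(Yᵢ(t))`. -/
def IsFTQLSolution (G : QuantumGame d Ω) (θ : ι → ℝ → ℝ) (Y : ℝ → ∀ i, Herm (d i)) : Prop :=
  ∃ X : ℝ → ∀ i, Herm (d i),
    (∀ t i, X t i ∈ regularizedBestResponse (θ i) (Y t i)) ∧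
    ∀ t, HasDerivAt Y (payoffGradient G (X t)) t

/-- `Z` is a solution on `ℝ` of the FTQL dynamics on traceless matrices
`dZᵢ/dt = Vᵢ(X(t)) - (1/dᵢ) tr(Vᵢ(X(t))) I`, `Xᵢ(t) = Qᵢ(Zᵢ(t))`. -/
def IsTracelessFTQLSolution (G : QuantumGame d Ω) (θ : ι → ℝ → ℝ)
    (Z : ℝ → ∀ i, Traceless (d i)) : Prop :=
  ∃ X : ℝ → ∀ i, Herm (d i),
    (∀ t i, X t i ∈ regularizedBestResponse (θ i) (Z t i).toHerm) ∧
    ∀ t, HasDerivAt Z (fun i => removeTrace (payoffGradient G (X t) i)) t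

/-- `φ` is the flow of a well-posed autonomous system with the given set of solutions: for every
initial condition `y`, the orbit `t ↦ φ t y` is the one and only solution that starts at `y`. -/
def IsFlowOf {E : Type*} [TopologicalSpace E] (φ : Flow ℝ E) (IsSolution : (ℝ → E) → Prop) :
    Prop :=
  ∀ y : ℝ → E, IsSolution y ↔ ∀ t, y t = φ t (y 0)

end Dynamics

end QuantumFTQL

open QuantumFTQL MeasureTheory

/-!
A trace function `X ↦ tr θ(X)` inherits strong convexity in the Frobenius norm from `θ`: the
diagonal of a Hermitian matrix in any orthonormal basis is the image of its spectrum under a doubly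
stochastic matrix (Peierls' inequality). Hence the regularized best response `Q` is single-valued
and Lipschitz, so `Y ↦ V(Q(Y))` is bounded and Lipschitz and has a global flow.

The payoff of a player is linear in the player's own matrix, so `Vᵢ` does not depend on `Xᵢ` and
the `i`-th component of the field does not depend on `Yᵢ`. As the field is only Lipschitz, its
divergence is avoided: an Euler step in a single coordinate is a shear, which preserves volume,
and the flow is the uniform limit of iterated compositions of such steps (Lie–Trotter splitting).
Adding a multiple of the identity to `Yᵢ` shifts the objective of the best response by a constant,
so `Π` semiconjugates the two dynamics.
-/

open Filter Topology
open scoped NNReal Matrix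

namespace QuantumFTQL

/-! ### Flows of bounded Lipschitz vector fields -/

/-- Bounded, globally Lipschitz maps; as vector fields they are complete. The constants are
existentially quantified, since only their existence matters for the dynamics. -/
structure IsBoundedLipschitz {X E : Type*} [PseudoEMetricSpace X] [SeminormedAddCommGroup E]
    (F : X → E) : Prop where
  lipschitz : ∃ K : ℝ≥0, LipschitzWith K F
  bounded : ∃ M : ℝ≥0, ∀ x, ‖F x‖ ≤ M

theorem isBoundedLipschitz_list_sum {E ι : Type*} [SeminormedAddCommGroup E]
    {F : ι → E → E} (hF : ∀ i, IsBoundedLipschitz (F i)) (l : List ι) :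
    IsBoundedLipschitz (l.map F).sum := by
  induction l with
  | nil => exact ⟨⟨0, LipschitzWith.const 0⟩, 0, fun x => by simp⟩
  | cons i l ih =>
    obtain ⟨⟨K, hK⟩, M, hM⟩ := hF i
    obtain ⟨⟨K', hK'⟩, M', hM'⟩ := ih
    rw [List.map_cons, List.sum_cons]
    exact ⟨⟨K + K', hK.add hK'⟩, M + M', fun x => norm_add_le_of_le (hM x) (hM' x)⟩

theorem IsBoundedLipschitz.single {ι : Type*} [Fintype ι] [DecidableEq ι] {E : ι → Type*}
    [∀ i, NormedAddCommGroup (E i)] {F : (∀ i, E i) → ∀ i, E i} (hF : IsBoundedLipschitz F)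
    (i : ι) : IsBoundedLipschitz fun y => (Pi.single i (F y i) : ∀ i, E i) := by
  obtain ⟨⟨K, hK⟩, M, hM⟩ := hF
  refine ⟨⟨K, LipschitzWith.of_dist_le_mul fun x y => ?_⟩, M, fun x => ?_⟩
  · rw [dist_eq_norm, ← Pi.single_sub, Pi.norm_single, ← dist_eq_norm]
    exact (dist_le_pi_dist (F x) (F y) i).trans (hK.dist_le_mul x y)
  · rw [Pi.norm_single]
    exact (norm_le_pi_norm (F x) i).trans (hM x)

theorem isBoundedLipschitz_domRestrict_of_contDiff {E F : Type*} [NormedAddCommGroup E]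
    [NormedSpace ℝ E] [NormedAddCommGroup F] [NormedSpace ℝ F] {f : E → F} (hf : ContDiff ℝ 1 f)
    {s : Set E} (hconv : Convex ℝ s) (hcomp : IsCompact s) :
    IsBoundedLipschitz (s.domRestrict f) := by
  obtain ⟨K, hK⟩ := hf.contDiffOn.exists_lipschitzOnWith one_ne_zero hconv hcomp
  obtain ⟨M, hM⟩ := hcomp.exists_bound_of_continuousOn hf.continuous.continuousOn
  exact ⟨⟨K, hK.to_restrict⟩, M.toNNReal, fun x => (hM x x.2).trans (Real.le_coe_toNNReal M)⟩

theorem IsBoundedLipschitz.comp {X X' E : Type*} [PseudoEMetricSpace X] [PseudoEMetricSpace X']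
    [SeminormedAddCommGroup E] {F : X → E} (hF : IsBoundedLipschitz F) {L : ℝ≥0} {g : X' → X}
    (hg : LipschitzWith L g) : IsBoundedLipschitz (F ∘ g) := by
  obtain ⟨⟨K, hK⟩, M, hM⟩ := hF
  exact ⟨⟨K * L, hK.comp hg⟩, M, fun x => hM (g x)⟩

theorem IsBoundedLipschitz.clm_comp {X E E' : Type*} [PseudoEMetricSpace X]
    [SeminormedAddCommGroup E] [NormedSpace ℝ E] [SeminormedAddCommGroup E'] [NormedSpace ℝ E']
    {F : X → E} (hF : IsBoundedLipschitz F) (L : E →L[ℝ] E') : IsBoundedLipschitz (L ∘ F) := by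
  obtain ⟨⟨K, hK⟩, M, hM⟩ := hF
  exact ⟨⟨‖L‖₊ * K, L.lipschitz.comp hK⟩, ‖L‖₊ * M, fun x => L.le_opNorm_of_le (hM x)⟩

theorem exists_lipschitzWith_piMap {ι : Type*} [Fintype ι] {E E' : ι → Type*}
    [∀ i, PseudoEMetricSpace (E i)] [∀ i, PseudoEMetricSpace (E' i)] {f : ∀ i, E i → E' i}
    (hf : ∀ i, ∃ L : ℝ≥0, LipschitzWith L (f i)) : ∃ L : ℝ≥0, LipschitzWith L (Pi.map f) := by
  choose L hL using hf
  refine ⟨∑ i, L i, fun x y => edist_pi_le_iff.2 fun i => (hL i (x i) (y i)).trans ?_⟩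
  gcongr
  · exact Finset.single_le_sum (fun _ _ => zero_le) (Finset.mem_univ i)
  · exact edist_le_pi_edist x y i

section FlowUniqueness

variable {X : Type*} [TopologicalSpace X] {φ ψ : Flow ℝ X} {S : (ℝ → X) → Prop}

theorem IsFlowOf.isSolution (hφ : IsFlowOf φ S) (x : X) : S fun t => φ t x :=
  (hφ _).2 fun t => by rw [φ.map_zero_apply]

theorem IsFlowOf.unique (hφ : IsFlowOf φ S) (hψ : IsFlowOf ψ S) : φ = ψ := by
  ext t x
  rw [(hψ _).1 (hφ.isSolution x) t, φ.map_zero_apply]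

end FlowUniqueness

section GlobalFlow

theorem continuous_of_dist_le_mul {T X Y : Type*} [TopologicalSpace T] [PseudoMetricSpace X]
    [PseudoMetricSpace Y] {f : T → X → Y} {L : T → ℝ} (hL : Continuous L)
    (hf : ∀ x, Continuous fun t => f t x)
    (hdist : ∀ t x x', dist (f t x) (f t x') ≤ dist x x' * L t) :
    Continuous fun p : T × X => f p.1 p.2 := by
  rw [continuous_iff_continuousAt]
  rintro ⟨s, x⟩
  rw [ContinuousAt, tendsto_iff_dist_tendsto_zero]
  have hle : ∀ p : T × X, dist (f p.1 p.2) (f s x) ≤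
      dist p.2 x * L p.1 + dist (f p.1 x) (f s x) := fun p =>
    (dist_triangle _ (f p.1 x) _).trans (by gcongr; exact hdist p.1 p.2 x)
  have hbound : Continuous fun p : T × X => dist p.2 x * L p.1 + dist (f p.1 x) (f s x) := by
    fun_prop
  exact squeeze_zero (fun _ => dist_nonneg) hle (by simpa using hbound.tendsto (s, x))

variable {E E' : Type*} [NormedAddCommGroup E] [NormedSpace ℝ E] [NormedAddCommGroup E']
  [NormedSpace ℝ E'] {F : E → E} {K : ℝ≥0}

theorem dist_isIntegralCurve_le_of_nonneg (hF : LipschitzWith K F) {y z : ℝ → E}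
    (hy : IsIntegralCurve y fun _ => F) (hz : IsIntegralCurve z fun _ => F) {t : ℝ} (ht : 0 ≤ t) :
    dist (y t) (z t) ≤ dist (y 0) (z 0) * Real.exp (K * t) := by
  simpa using dist_le_of_trajectories_ODE (v := fun _ => F) (fun _ => hF)
    hy.continuous.continuousOn (fun s _ => (hy s).hasDerivWithinAt)
    hz.continuous.continuousOn (fun s _ => (hz s).hasDerivWithinAt) le_rfl t ⟨ht, le_rfl⟩

theorem isIntegralCurve_comp_neg {y : ℝ → E} (hy : IsIntegralCurve y fun _ => F) :
    IsIntegralCurve (fun t => y (-t)) fun _ => -F := by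
  have hrev := hy.comp_mul (-1)
  simp only [Function.comp_def, mul_neg_one] at hrev
  rwa [neg_one_smul] at hrev

theorem dist_isIntegralCurve_le (hF : LipschitzWith K F) {y z : ℝ → E}
    (hy : IsIntegralCurve y fun _ => F) (hz : IsIntegralCurve z fun _ => F) (t : ℝ) :
    dist (y t) (z t) ≤ dist (y 0) (z 0) * Real.exp (K * |t|) := by
  rcases le_total 0 t with ht | ht
  · rw [abs_of_nonneg ht]
    exact dist_isIntegralCurve_le_of_nonneg hF hy hz ht
  · rw [abs_of_nonpos ht]
    simpa using dist_isIntegralCurve_le_of_nonneg hF.neg (isIntegralCurve_comp_neg hy)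
      (isIntegralCurve_comp_neg hz) (neg_nonneg.2 ht)

theorem isIntegralCurve_eq_of_eq_zero (hF : LipschitzWith K F) {y z : ℝ → E}
    (hy : IsIntegralCurve y fun _ => F) (hz : IsIntegralCurve z fun _ => F) (h0 : y 0 = z 0) :
    y = z :=
  funext fun t => dist_le_zero.1 <| by
    simpa only [h0, dist_self, zero_mul] using dist_isIntegralCurve_le hF hy hz t

theorem exists_isIntegralCurve_of_Ioo (hF : LipschitzWith K F) {x : E}
    (hloc : ∀ T : ℝ, ∃ α : ℝ → E, α 0 = x ∧ ∀ t ∈ Set.Ioo (-T) T, HasDerivAt α (F (α t)) t) :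
    ∃ y : ℝ → E, y 0 = x ∧ IsIntegralCurve y fun _ => F := by
  choose α hα0 hα using hloc
  have hagree : ∀ {S T s : ℝ}, |s| < S → |s| < T → α S s = α T s := by
    intro S T s hS hT
    have hsub : ∀ R, min S T ≤ R → Set.Ioo (-min S T) (min S T) ⊆ Set.Ioo (-R) R :=
      fun R hR => Set.Ioo_subset_Ioo (neg_le_neg hR) hR
    refine ODE_solution_unique_of_mem_Ioo (v := fun _ => F) (s := fun _ => Set.univ) (t₀ := 0)
      (fun _ _ => hF.lipschitzOnWith) ?_
      (fun t ht => ⟨hα S t (hsub S (min_le_left S T) ht), trivial⟩)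
      (fun t ht => ⟨hα T t (hsub T (min_le_right S T) ht), trivial⟩) ((hα0 S).trans (hα0 T).symm)
      (abs_lt.1 (lt_min hS hT))
    exact abs_lt.1 (abs_zero.trans_lt ((abs_nonneg s).trans_lt (lt_min hS hT)))
  refine ⟨fun t => α (|t| + 1) t, hα0 _, fun t => ?_⟩
  have hnear : (fun s => α (|s| + 1) s) =ᶠ[𝓝 t] α (|t| + 1) := by
    filter_upwards [(continuous_abs.tendsto t).eventually_lt_const (lt_add_one |t|)] with s hs
    exact hagree (lt_add_one |s|) hs
  exact (hα (|t| + 1) t (abs_lt.1 (lt_add_one |t|))).congr_of_eventuallyEq hnear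

theorem IsBoundedLipschitz.exists_isIntegralCurve [CompleteSpace E] (hF : IsBoundedLipschitz F)
    (x : E) : ∃ y : ℝ → E, y 0 = x ∧ IsIntegralCurve y fun _ => F := by
  obtain ⟨⟨K, hK⟩, M, hM⟩ := hF
  refine exists_isIntegralCurve_of_Ioo hK fun T => ?_
  have hPL : IsPicardLindelof (fun _ => F) (tmin := -|T|) (tmax := |T|)
      ⟨0, neg_nonpos.2 (abs_nonneg T), abs_nonneg T⟩ x (M * ‖T‖₊) 0 M K :=
    { lipschitzOnWith := fun _ _ => hK.lipschitzOnWith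
      continuousOn := fun _ _ => continuousOn_const
      norm_le := fun _ _ x _ => hM x
      mul_max_le := by simp }
  obtain ⟨α, hα0, hα⟩ := hPL.exists_eq_forall_mem_Icc_hasDerivWithinAt₀
  refine ⟨α, hα0, fun t ht => ?_⟩
  have hmem : Set.Icc (-|T|) |T| ∈ 𝓝 t := by
    have hT := le_abs_self T
    exact Icc_mem_nhds (by linarith [ht.1]) (by linarith [ht.2])
  exact (hα t (mem_of_mem_nhds hmem)).hasDerivAt hmem

theorem IsBoundedLipschitz.exists_isFlowOf [CompleteSpace E] (hF : IsBoundedLipschitz F) :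
    ∃ φ : Flow ℝ E, IsFlowOf φ fun y => IsIntegralCurve y fun _ => F := by
  obtain ⟨K, hK⟩ := hF.lipschitz
  choose Φ hΦ0 hΦ using hF.exists_isIntegralCurve
  have hcont : Continuous fun p : ℝ × E => Φ p.2 p.1 :=
    continuous_of_dist_le_mul (f := fun t x => Φ x t) (L := fun t => Real.exp (K * |t|))
      (by fun_prop) (fun x => (hΦ x).continuous) fun t x x' => by
        simpa only [hΦ0] using dist_isIntegralCurve_le hK (hΦ x) (hΦ x') t
  let φ : Flow ℝ E :=
    { toFun := fun t x => Φ x t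
      cont' := hcont
      map_add' := fun s t x => congrFun (isIntegralCurve_eq_of_eq_zero hK ((hΦ x).comp_add t)
        (hΦ (Φ x t)) (by simp only [Function.comp_apply, zero_add, hΦ0])) s
      map_zero' := hΦ0 }
  refine ⟨φ, fun y => ⟨fun hy => congrFun ?_, fun hy => ?_⟩⟩
  · exact isIntegralCurve_eq_of_eq_zero hK hy (hΦ (y 0)) (hΦ0 _).symm
  · rw [show y = Φ (y 0) from funext hy]
    exact hΦ (y 0)

theorem flow_semiconj_of_map_field {G : E' → E'} {φ : Flow ℝ E} {ψ : Flow ℝ E'}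
    (hφ : IsFlowOf φ fun y => IsIntegralCurve y fun _ => F)
    (hψ : IsFlowOf ψ fun z => IsIntegralCurve z fun _ => G) (L : E →L[ℝ] E')
    (hL : Function.Semiconj L F G) (t : ℝ) : Function.Semiconj L (φ t) (ψ t) := by
  intro y
  have hcurve : IsIntegralCurve (fun t => L (φ t y)) fun _ => G := fun s => by
    exact (L.hasFDerivAt.comp_hasDerivAt s (hφ.isSolution y s)).congr_deriv (hL (φ s y))
  rw [(hψ _).1 hcurve t, φ.map_zero_apply]

theorem dist_flow_le (hF : LipschitzWith K F) {φ : Flow ℝ E}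
    (hφ : IsFlowOf φ fun y => IsIntegralCurve y fun _ => F) (t : ℝ) (x y : E) :
    dist (φ t x) (φ t y) ≤ dist x y * Real.exp (K * |t|) := by
  simpa only [φ.map_zero_apply] using
    dist_isIntegralCurve_le hF (hφ.isSolution x) (hφ.isSolution y) t

end GlobalFlow

/-! ### One-step methods and splitting -/

section OneStep

variable {E : Type*} [NormedAddCommGroup E] [NormedSpace ℝ E] {F G : E → E} {S : ℝ → E → E}

/-- `S` is consistent with the vector field `F`: the one-step method `S h` of step size `h` agrees
with the Euler step of `F` up to an error of order `h ^ 2`, uniformly in space. -/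
def IsConsistent (S : ℝ → E → E) (F : E → E) : Prop :=
  ∃ C : ℝ≥0, ∀ h y, ‖S h y - (y + h • F y)‖ ≤ C * h ^ 2

theorem isConsistent_id : IsConsistent (fun _ y => y) (0 : E → E) :=
  ⟨0, fun h y => by simp⟩

theorem IsConsistent.comp_euler (hS : IsConsistent S G) (hG : IsBoundedLipschitz G)
    (hF : IsBoundedLipschitz F) : IsConsistent (fun h y => S h (y + h • F y)) (F + G) := by
  obtain ⟨C, hC⟩ := hS
  obtain ⟨K, hK⟩ := hG.lipschitz
  obtain ⟨M, hM⟩ := hF.bounded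
  refine ⟨C + K * M, fun h y => ?_⟩
  have hdrift : ‖G (y + h • F y) - G y‖ ≤ K * (|h| * M) := by
    refine (hK.norm_sub_le _ _).trans ?_
    rw [add_sub_cancel_left, norm_smul, Real.norm_eq_abs]
    gcongr
    exact hM y
  calc ‖S h (y + h • F y) - (y + h • (F + G) y)‖
      = ‖(S h (y + h • F y) - (y + h • F y + h • G (y + h • F y))) +
          h • (G (y + h • F y) - G y)‖ := by
        congr 1
        simp only [Pi.add_apply, smul_add, smul_sub]
        abel
    _ ≤ C * h ^ 2 + |h| * (K * (|h| * M)) := by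
        refine (norm_add_le _ _).trans (add_le_add (hC h _) ?_)
        rw [norm_smul, Real.norm_eq_abs]
        gcongr
    _ = ↑(C + K * M) * h ^ 2 := by
        rw [← sq_abs h]
        push_cast
        ring

theorem IsBoundedLipschitz.isConsistent_flow (hF : IsBoundedLipschitz F) {φ : Flow ℝ E}
    (hφ : IsFlowOf φ fun y => IsIntegralCurve y fun _ => F) : IsConsistent (fun h => φ h) F := by
  obtain ⟨⟨K, hK⟩, M, hM⟩ := hF
  refine ⟨K * M, fun h y => ?_⟩
  have hcurve : ∀ s, HasDerivAt (fun s => φ s y) (F (φ s y)) s := hφ.isSolution y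
  have hdisp : ∀ s ∈ Set.uIcc 0 h, ‖φ s y - y‖ ≤ M * |h| := fun s hs => by
    have hmvt := convex_univ.norm_image_sub_le_of_norm_hasDerivWithin_le
      (fun t _ => (hcurve t).hasDerivWithinAt) (fun t _ => hM _) (Set.mem_univ 0) (Set.mem_univ s)
    simp only [φ.map_zero_apply, Real.norm_eq_abs] at hmvt
    refine hmvt.trans (mul_le_mul_of_nonneg_left ?_ M.2)
    simpa only [sub_zero] using Set.abs_sub_left_of_mem_uIcc hs
  have hmvt := (convex_uIcc 0 h).norm_image_sub_le_of_norm_hasDerivWithin_le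
    (f := fun s => φ s y - s • F y) (C := K * (M * |h|))
    (fun s _ => ((hcurve s).fun_sub ((hasDerivAt_id s).smul_const (F y))).hasDerivWithinAt)
    (fun s hs => by
      rw [one_smul]
      exact (hK.norm_sub_le _ _).trans (by gcongr; exact hdisp s hs))
    Set.left_mem_uIcc Set.right_mem_uIcc
  calc ‖φ h y - (y + h • F y)‖
      = ‖φ h y - h • F y - (φ 0 y - (0 : ℝ) • F y)‖ := by
        rw [φ.map_zero_apply, zero_smul, sub_zero, sub_sub, add_comm]
    _ ≤ K * (M * |h|) * ‖h - 0‖ := hmvt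
    _ = ↑(K * M) * h ^ 2 := by
        rw [sub_zero, Real.norm_eq_abs, ← sq_abs h]
        push_cast
        ring

/-- One step of the Lie–Trotter splitting of the vector field `(l.map F).sum`: the Euler steps of
the summands, performed in the order of the list. -/
def splittingStep {ι : Type*} (F : ι → E → E) (l : List ι) (h : ℝ) (y : E) : E :=
  l.foldl (fun z i => z + h • F i z) y

theorem isConsistent_splittingStep {ι : Type*} {F : ι → E → E}
    (hF : ∀ i, IsBoundedLipschitz (F i)) (l : List ι) :
    IsConsistent (splittingStep F l) (l.map F).sum := by
  induction l with
  | nil => exact isConsistent_id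
  | cons i l ih => exact ih.comp_euler (isBoundedLipschitz_list_sum hF l) (hF i)

theorem measurePreserving_splittingStep {ι : Type*} [MeasurableSpace E] {μ : Measure E}
    {F : ι → E → E} {h : ℝ} (hF : ∀ i, MeasurePreserving (fun y => y + h • F i y) μ μ)
    (l : List ι) : MeasurePreserving (splittingStep F l h) μ μ := by
  induction l with
  | nil => exact MeasurePreserving.id μ
  | cons i l ih => exact ih.comp (hF i)

end OneStep

section GlobalError

variable {X : Type*} [PseudoMetricSpace X] {φ : Flow ℝ X} {K : ℝ≥0}

theorem dist_flow_iterate_le (hφ : ∀ t x y, dist (φ t x) (φ t y) ≤ dist x y * Real.exp (K * |t|))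
    {S : X → X} {h ε : ℝ} (hε : 0 ≤ ε) (hS : ∀ x, dist (φ h x) (S x) ≤ ε) (n : ℕ) (x : X) :
    dist (φ (n * h) x) (S^[n] x) ≤ n * ε * Real.exp (K * (n * |h|)) := by
  induction n with
  | zero => simp
  | succ n ih =>
    rw [Function.iterate_succ_apply', Nat.cast_add_one, add_one_mul (n : ℝ) h, add_comm _ h,
      φ.map_add]
    have hexp : 1 ≤ Real.exp (K * (n * |h| + |h|)) := Real.one_le_exp (by positivity)
    calc dist (φ h (φ (n * h) x)) (S (S^[n] x))
        ≤ dist (φ h (φ (n * h) x)) (φ h (S^[n] x)) + dist (φ h (S^[n] x)) (S (S^[n] x)) :=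
          dist_triangle _ _ _
      _ ≤ n * ε * Real.exp (K * (n * |h|)) * Real.exp (K * |h|) + ε :=
          add_le_add ((hφ _ _ _).trans (by gcongr)) (hS _)
      _ = n * ε * Real.exp (K * (n * |h| + |h|)) + ε * 1 := by
          rw [mul_assoc, ← Real.exp_add, ← mul_add, mul_one]
      _ ≤ n * ε * Real.exp (K * (n * |h| + |h|)) + ε * Real.exp (K * (n * |h| + |h|)) := by gcongr
      _ = (n + 1) * ε * Real.exp (K * ((n + 1) * |h|)) := by rw [add_one_mul (n : ℝ) |h|]; ring

theorem tendstoUniformly_iterate_flow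
    (hφ : ∀ t x y, dist (φ t x) (φ t y) ≤ dist x y * Real.exp (K * |t|)) {S : ℝ → X → X} {C : ℝ≥0}
    (hS : ∀ h x, dist (φ h x) (S h x) ≤ C * h ^ 2) (t : ℝ) :
    TendstoUniformly (fun n : ℕ => (S (t / n))^[n]) (φ t) atTop := by
  have hle : ∀ n : ℕ, n ≠ 0 → ∀ x,
      dist (φ t x) ((S (t / n))^[n] x) ≤ C * t ^ 2 * Real.exp (K * |t|) / n := fun n hn x => by
    have hn' : (n : ℝ) ≠ 0 := Nat.cast_ne_zero.2 hn
    have herr := dist_flow_iterate_le hφ (by positivity) (hS (t / n)) n x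
    rw [mul_div_cancel₀ t hn', abs_div, Nat.abs_cast, mul_div_cancel₀ _ hn'] at herr
    exact herr.trans_eq (by field_simp)
  have hlim : Tendsto (fun n : ℕ => C * t ^ 2 * Real.exp (K * |t|) / n) atTop (𝓝 0) :=
    tendsto_const_div_atTop_nhds_zero_nat _
  refine Metric.tendstoUniformly_iff.2 fun ε hε => ?_
  filter_upwards [hlim.eventually_lt_const hε, eventually_ne_atTop 0] with n hn hn0 x
  exact (hle n hn0 x).trans_lt hn

end GlobalError

theorem IsConsistent.tendstoUniformly_iterate {E : Type*} [NormedAddCommGroup E] [NormedSpace ℝ E]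
    {F : E → E} {S : ℝ → E → E} (hS : IsConsistent S F) (hF : IsBoundedLipschitz F)
    {φ : Flow ℝ E} (hφ : IsFlowOf φ fun y => IsIntegralCurve y fun _ => F) (t : ℝ) :
    TendstoUniformly (fun n : ℕ => (S (t / n))^[n]) (φ t) atTop := by
  obtain ⟨K, hK⟩ := hF.lipschitz
  obtain ⟨C, hC⟩ := hS
  obtain ⟨C', hC'⟩ := hF.isConsistent_flow hφ
  refine tendstoUniformly_iterate_flow (C := C' + C) (dist_flow_le hK hφ) (fun h y => ?_) t
  rw [NNReal.coe_add, add_mul]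
  refine (dist_triangle_right _ _ (y + h • F y)).trans ?_
  rw [dist_eq_norm, dist_eq_norm]
  exact add_le_add (hC' h y) (hC h y)

/-! ### Liouville's theorem -/

section Liouville

theorem measurePreserving_of_tendstoUniformly {X : Type*} [PseudoMetricSpace X] [ProperSpace X]
    [T2Space X] [MeasurableSpace X] [BorelSpace X] {μ : Measure X} [μ.Regular] {T : ℕ → X → X}
    (hT : ∀ n, MeasurePreserving (T n) μ μ) (Ψ : X ≃ₜ X) (hlim : TendstoUniformly T Ψ atTop) :
    MeasurePreserving Ψ μ μ := by
  refine ⟨Ψ.continuous.measurable, ?_⟩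
  have : (μ.map Ψ).Regular := Measure.Regular.map Ψ
  refine Measure.ext_of_integral_eq_on_compactlySupported fun f => ?_
  rw [Ψ.measurableEmbedding.integral_map]
  have hint : ∀ n, ∫ x, f (T n x) ∂μ = ∫ x, f x ∂μ := fun n => by
    conv_rhs => rw [← (hT n).map_eq]
    exact (integral_map (hT n).aemeasurable f.continuous.aestronglyMeasurable).symm
  have hcomp : IsCompact (Ψ ⁻¹' Metric.cthickening 1 (tsupport f)) :=
    Ψ.isCompact_preimage.2 f.hasCompactSupport.isCompact.cthickening
  obtain ⟨C, hC⟩ := f.hasCompactSupport.exists_bound_of_continuous f.continuous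
  have htendsto : Tendsto (fun n => ∫ x, f (T n x) ∂μ) atTop (𝓝 (∫ x, f (Ψ x) ∂μ)) := by
    refine tendsto_integral_filter_of_dominated_convergence
      ((Ψ ⁻¹' Metric.cthickening 1 (tsupport f)).indicator fun _ => C)
      (Eventually.of_forall fun n =>
        (f.continuous.measurable.comp (hT n).measurable).aestronglyMeasurable)
      ?_
      ((integrable_indicator_iff hcomp.measurableSet).2
        (integrableOn_const hcomp.measure_lt_top.ne))
      (Eventually.of_forall fun x => (f.continuous.tendsto _).comp (hlim.tendsto_at x))
    filter_upwards [Metric.tendstoUniformly_iff.1 hlim 1 one_pos] with n hn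
    refine Eventually.of_forall fun x => ?_
    by_cases hx : Ψ x ∈ Metric.cthickening 1 (tsupport f)
    · rw [Set.indicator_of_mem (Set.mem_preimage.2 hx)]
      exact hC _
    · have hnotMem : T n x ∉ tsupport f := fun hmem =>
        hx (Metric.mem_cthickening_of_dist_le _ _ _ _ hmem (hn x).le)
      rw [image_eq_zero_of_notMem_tsupport hnotMem, norm_zero]
      exact Set.indicator_nonneg (fun _ _ => (norm_nonneg _).trans (hC x)) x
  simp only [hint] at htendsto
  exact tendsto_nhds_unique htendsto tendsto_const_nhds

theorem measurePreserving_flow_of_splitting {E ι : Type*} [NormedAddCommGroup E] [NormedSpace ℝ E]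
    [ProperSpace E] [MeasurableSpace E] [BorelSpace E] {μ : Measure E} [μ.Regular] [Fintype ι]
    {F : ι → E → E} (hF : ∀ i, IsBoundedLipschitz (F i))
    (hpres : ∀ i (h : ℝ), MeasurePreserving (fun y => y + h • F i y) μ μ) {φ : Flow ℝ E}
    (hφ : IsFlowOf φ fun y => IsIntegralCurve y fun _ => ∑ i, F i) (t : ℝ) :
    MeasurePreserving (φ t) μ μ := by
  have hsum : ((Finset.univ : Finset ι).toList.map F).sum = ∑ i, F i :=
    Finset.sum_map_toList _ _
  rw [← hsum] at hφ
  exact measurePreserving_of_tendstoUniformly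
    (fun n => (measurePreserving_splittingStep (fun i => hpres i (t / n)) _).iterate n)
    (φ.toHomeomorph t)
    ((isConsistent_splittingStep hF _).tendstoUniformly_iterate
      (isBoundedLipschitz_list_sum hF _) hφ t)

theorem measurePreserving_add_single {ι : Type*} [Fintype ι] [DecidableEq ι] {E : ι → Type*}
    [∀ i, AddGroup (E i)] [∀ i, MeasurableSpace (E i)] [∀ i, MeasurableAdd₂ (E i)]
    {μ : ∀ i, Measure (E i)} [∀ i, SigmaFinite (μ i)] {i : ι} [(μ i).IsAddRightInvariant]
    {g : (∀ i, E i) → E i} (hg : Measurable g) (hgi : ∀ y e, g (Function.update y i e) = g y) :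
    MeasurePreserving (fun y => y + Pi.single i (g y)) (Measure.pi μ) (Measure.pi μ) := by
  have hmeas : Measurable fun y : ∀ i, E i => y + Pi.single i (g y) :=
    measurable_id.add ((measurable_update' (a := i)).comp (measurable_const.prodMk hg))
  refine ⟨hmeas, Measure.ext_of_lintegral _ fun f hf => ?_⟩
  rw [lintegral_map hf hmeas]
  refine lintegral_eq_of_lmarginal_eq {i} (hf.comp hmeas) hf (funext fun x => ?_)
  have hshift : ∀ z : E i, Function.update x i z + Pi.single i (g (Function.update x i z)) =
      Function.update x i (z + g x) := fun z => by
    ext j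
    rcases eq_or_ne j i with rfl | hj <;> simp [*]
  simp only [lmarginal_singleton, hshift]
  exact lintegral_add_right_eq_self (fun z => f (Function.update x i z)) (g x)

variable {ι : Type*} [Fintype ι] [DecidableEq ι] {E : ι → Type*} [∀ i, NormedAddCommGroup (E i)]
  [∀ i, NormedSpace ℝ (E i)]

theorem measurePreserving_flow_of_update [∀ i, FiniteDimensional ℝ (E i)]
    [∀ i, MeasurableSpace (E i)] [∀ i, BorelSpace (E i)] {μ : ∀ i, Measure (E i)}
    [∀ i, (μ i).IsAddHaarMeasure] {F : (∀ i, E i) → ∀ i, E i} (hF : IsBoundedLipschitz F)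
    (hFi : ∀ i y e, F (Function.update y i e) i = F y i) {φ : Flow ℝ (∀ i, E i)}
    (hφ : IsFlowOf φ fun y => IsIntegralCurve y fun _ => F) (t : ℝ) :
    MeasurePreserving (φ t) (Measure.pi μ) (Measure.pi μ) := by
  have : ∀ i, ProperSpace (E i) := fun i => FiniteDimensional.proper_real (E i)
  obtain ⟨K, hK⟩ := hF.lipschitz
  have hsplit : ∑ i, (fun y => (Pi.single i (F y i) : ∀ i, E i)) = F := by
    ext1 y
    rw [Finset.sum_apply, Finset.univ_sum_single]
  refine measurePreserving_flow_of_splitting hF.single (fun i h => ?_) (by rwa [hsplit]) t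
  simp only [← Pi.single_smul]
  refine measurePreserving_add_single ?_ fun y e => by rw [hFi]
  exact (((continuous_apply i).comp hK.continuous).const_smul h).measurable

theorem measure_image_flow {X : Type*} [TopologicalSpace X] [MeasurableSpace X] [BorelSpace X]
    {μ : Measure X} {φ : Flow ℝ X} {t : ℝ} (hφ : MeasurePreserving (φ t) μ μ) (U : Set X) :
    μ (φ t '' U) = μ U := by
  have hemb : MeasurableEmbedding (φ t) := (φ.toHomeomorph t).measurableEmbedding
  rw [← hφ.measure_preimage_emb hemb, Set.preimage_image_eq _ hemb.injective]

end Liouville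

/-! ### Convexity of trace functions -/

section DoublyStochastic

variable {n : Type*} [Fintype n] [DecidableEq n]

theorem map_normSq_mem_doublyStochastic (W : Matrix.unitaryGroup n ℂ) :
    W.1.map Complex.normSq ∈ doublyStochastic ℝ n := by
  refine mem_doublyStochastic_iff_sum.2
    ⟨fun _ _ => Complex.normSq_nonneg _, fun i => ?_, fun j => ?_⟩
  · have hrow := congrArg Complex.re (congrFun₂ (Unitary.coe_mul_star_self W) i i)
    simpa [Matrix.mul_apply, Matrix.star_apply, Complex.normSq_apply] using hrow
  · have hcol := congrArg Complex.re (congrFun₂ (Unitary.coe_star_mul_self W) j j)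
    simpa [Matrix.mul_apply, Matrix.star_apply, Complex.normSq_apply] using hcol

theorem re_conj_diagonal_apply_self (W : Matrix n n ℂ) (v : n → ℝ) (k : n) :
    ((W * Matrix.diagonal (fun j => (v j : ℂ)) * star W) k k).re =
      (W.map Complex.normSq *ᵥ v) k := by
  rw [Matrix.mul_apply, Complex.re_sum, Matrix.mulVec_eq_sum, Finset.sum_apply]
  refine Finset.sum_congr rfl fun j _ => ?_
  rw [Matrix.mul_diagonal, Matrix.star_apply, mul_right_comm, Complex.star_def, Complex.mul_conj]
  simp [mul_comm]

variable {D : Matrix n n ℝ} {s : Set ℝ} {v : n → ℝ}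

theorem mulVec_mem_of_mem_doublyStochastic (hD : D ∈ doublyStochastic ℝ n) (hs : Convex ℝ s)
    (hv : ∀ j, v j ∈ s) (k : n) : (D *ᵥ v) k ∈ s :=
  hs.sum_mem (fun _ _ => nonneg_of_mem_doublyStochastic hD) (sum_row_of_mem_doublyStochastic hD k)
    fun j _ => hv j

theorem sum_map_mulVec_le_of_mem_doublyStochastic (hD : D ∈ doublyStochastic ℝ n) {g : ℝ → ℝ}
    (hg : ConvexOn ℝ s g) (hv : ∀ j, v j ∈ s) : ∑ k, g ((D *ᵥ v) k) ≤ ∑ j, g (v j) :=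
  calc ∑ k, g ((D *ᵥ v) k)
      ≤ ∑ k, ∑ j, D k j * g (v j) :=
        Finset.sum_le_sum fun k _ => hg.map_sum_le (fun _ _ => nonneg_of_mem_doublyStochastic hD)
          (sum_row_of_mem_doublyStochastic hD k) fun j _ => hv j
    _ = ∑ j, g (v j) := by
        rw [Finset.sum_comm]
        refine Finset.sum_congr rfl fun j _ => ?_
        rw [← Finset.sum_mul, sum_col_of_mem_doublyStochastic hD, one_mul]

end DoublyStochastic

section TraceFunction

variable {n : ℕ}

theorem continuous_mat : Continuous (Herm.mat : Herm n → Matrix (Fin n) (Fin n) ℂ) :=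
  LinearMap.continuous_of_finiteDimensional
    (⟨⟨Herm.mat, Herm.mat_add⟩, Herm.mat_smul⟩ : Herm n →ₗ[ℝ] Matrix (Fin n) (Fin n) ℂ)

/-- The Hermitian matrices with spectrum in `s`: the domain on which the trace function of a
function defined on `s` is meaningful. -/
def spectrumIn (n : ℕ) (s : Set ℝ) : Set (Herm n) := {A | spectrum ℝ A.mat ⊆ s}

theorem mem_spectrumIn {s : Set ℝ} {A : Herm n} :
    A ∈ spectrumIn n s ↔ ∀ k, A.isHermitian.eigenvalues k ∈ s := by
  rw [spectrumIn, Set.mem_ofPred_eq, A.isHermitian.spectrum_real_eq_range_eigenvalues,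
    Set.range_subset_iff]

theorem regularizer_eq_sum (g : ℝ → ℝ) (A : Herm n) :
    regularizer g A = ∑ k, g (A.isHermitian.eigenvalues k) := by
  rw [regularizer, Matrix.IsHermitian.cfc, Unitary.conjStarAlgAut_apply, Matrix.trace_mul_comm,
    ← mul_assoc, Unitary.coe_star_mul_self, one_mul, Matrix.trace_diagonal, Complex.re_sum]
  exact Finset.sum_congr rfl fun k _ => Complex.ofReal_re _

theorem regularizer_sq (A : Herm n) : regularizer (fun x => x ^ 2) A = ‖A‖ ^ 2 := by
  have hA : IsSelfAdjoint A.mat := A.isHermitian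
  rw [regularizer, ← A.isHermitian.cfc_eq, cfc_pow_id A.mat 2 hA,
    ← real_inner_self_eq_norm_sq, Herm.inner_def, Herm.pairing, sq]

open scoped Matrix.Norms.L2Operator in
theorem continuousOn_regularizer {g : ℝ → ℝ} {s : Set ℝ} (hs : IsCompact s)
    (hg : ContinuousOn g s) : ContinuousOn (regularizer g) (spectrumIn n s) := by
  have hcfc : ContinuousOn (fun A : Herm n => cfc g A.mat) (spectrumIn n s) :=
    (continuousOn_cfc (p := IsSelfAdjoint) (Matrix (Fin n) (Fin n) ℂ) hs g hg).comp
      continuous_mat.continuousOn fun A hA => ⟨A.isHermitian, hA⟩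
  have htrace : Continuous fun M : Matrix (Fin n) (Fin n) ℂ => M.trace.re :=
    Complex.continuous_re.comp continuous_id.matrix_trace
  refine (htrace.comp_continuousOn hcfc).congr fun A _ => ?_
  rw [regularizer, Function.comp_apply, A.isHermitian.cfc_eq]

/-- The `k`-th diagonal entry of a Hermitian matrix in the orthonormal basis formed by the columns
of `U`. -/
def diagEntry (U : Matrix.unitaryGroup (Fin n) ℂ) (A : Herm n) (k : Fin n) : ℝ :=
  ((star U.1 * A.mat * U.1) k k).re

theorem diagEntry_add_smul (U : Matrix.unitaryGroup (Fin n) ℂ) (A B : Herm n) (a b : ℝ)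
    (k : Fin n) : diagEntry U (a • A + b • B) k = a * diagEntry U A k + b * diagEntry U B k := by
  simp [diagEntry, mul_add, add_mul]

theorem diagEntry_eigenvectorUnitary (A : Herm n) (k : Fin n) :
    diagEntry A.isHermitian.eigenvectorUnitary A k = A.isHermitian.eigenvalues k := by
  have hdiag := A.isHermitian.conjStarAlgAut_star_eigenvectorUnitary
  rw [Unitary.conjStarAlgAut_star_apply] at hdiag
  rw [diagEntry, ← Complex.ofReal_re (A.isHermitian.eigenvalues k)]
  refine congrArg Complex.re ((congrFun₂ hdiag k k).trans ?_)
  rw [Matrix.diagonal_apply_eq]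
  rfl

theorem exists_diagEntry_eq_mulVec (U : Matrix.unitaryGroup (Fin n) ℂ) (A : Herm n) :
    ∃ D ∈ doublyStochastic ℝ (Fin n), diagEntry U A = D *ᵥ A.isHermitian.eigenvalues := by
  set V := A.isHermitian.eigenvectorUnitary
  refine ⟨_, map_normSq_mem_doublyStochastic (star U * V), funext fun k => ?_⟩
  have hspec : A.mat = V.1 * Matrix.diagonal (fun j => (A.isHermitian.eigenvalues j : ℂ)) *
      star V.1 := by
    have hspec := A.isHermitian.spectral_theorem
    rwa [Unitary.conjStarAlgAut_apply] at hspec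
  rw [← re_conj_diagonal_apply_self, diagEntry]
  conv_lhs => rw [hspec]
  simp only [Submonoid.coe_mul, Unitary.coe_star, star_mul, star_star, mul_assoc]

variable {s : Set ℝ} {g : ℝ → ℝ}

theorem diagEntry_mem (hs : Convex ℝ s) (U : Matrix.unitaryGroup (Fin n) ℂ) {A : Herm n}
    (hA : A ∈ spectrumIn n s) (k : Fin n) : diagEntry U A k ∈ s := by
  obtain ⟨D, hD, hdiag⟩ := exists_diagEntry_eq_mulVec U A
  rw [hdiag]
  exact mulVec_mem_of_mem_doublyStochastic hD hs (mem_spectrumIn.1 hA) k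

/-- **Peierls' inequality.** -/
theorem sum_diagEntry_le_regularizer (hg : ConvexOn ℝ s g) (U : Matrix.unitaryGroup (Fin n) ℂ)
    {A : Herm n} (hA : A ∈ spectrumIn n s) : ∑ k, g (diagEntry U A k) ≤ regularizer g A := by
  obtain ⟨D, hD, hdiag⟩ := exists_diagEntry_eq_mulVec U A
  rw [hdiag, regularizer_eq_sum]
  exact sum_map_mulVec_le_of_mem_doublyStochastic hD hg (mem_spectrumIn.1 hA)

theorem convex_spectrumIn (hs : Convex ℝ s) : Convex ℝ (spectrumIn n s) := by
  intro A hA B hB a b ha hb hab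
  refine mem_spectrumIn.2 fun k => ?_
  rw [← diagEntry_eigenvectorUnitary, diagEntry_add_smul]
  exact hs (diagEntry_mem hs _ hA k) (diagEntry_mem hs _ hB k) ha hb hab

theorem convexOn_regularizer (hg : ConvexOn ℝ s g) :
    ConvexOn ℝ (spectrumIn n s) (regularizer g) := by
  refine ⟨convex_spectrumIn hg.1, fun A hA B hB a b ha hb hab => ?_⟩
  -- In an eigenbasis of the convex combination, Peierls' inequality bounds both terms.
  set U := (a • A + b • B).isHermitian.eigenvectorUnitary
  calc regularizer g (a • A + b • B)
      = ∑ k, g (a * diagEntry U A k + b * diagEntry U B k) := by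
        simp only [regularizer_eq_sum, ← diagEntry_eigenvectorUnitary, diagEntry_add_smul, U]
    _ ≤ ∑ k, (a * g (diagEntry U A k) + b * g (diagEntry U B k)) :=
        Finset.sum_le_sum fun k _ =>
          hg.2 (diagEntry_mem hg.1 U hA k) (diagEntry_mem hg.1 U hB k) ha hb hab
    _ = a * ∑ k, g (diagEntry U A k) + b * ∑ k, g (diagEntry U B k) := by
        rw [Finset.sum_add_distrib, Finset.mul_sum, Finset.mul_sum]
    _ ≤ a * regularizer g A + b * regularizer g B := by
        gcongr
        · exact sum_diagEntry_le_regularizer hg U hA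
        · exact sum_diagEntry_le_regularizer hg U hB

theorem strongConvexOn_regularizer {m : ℝ} (hg : StrongConvexOn s m g) :
    StrongConvexOn (spectrumIn n s) m (regularizer g) := by
  rw [strongConvexOn_iff_convex] at hg ⊢
  have hsub : ∀ A : Herm n, regularizer (fun x => g x - m / 2 * ‖x‖ ^ 2) A =
      regularizer g A - m / 2 * ‖A‖ ^ 2 := fun A => by
    rw [← regularizer_sq]
    simp only [regularizer_eq_sum, Finset.sum_sub_distrib, Finset.mul_sum, Real.norm_eq_abs,
      sq_abs]
  rw [← funext hsub]
  exact convexOn_regularizer hg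

end TraceFunction

/-! ### Density matrices and best responses -/

section Spectraplex

variable {n : ℕ}

theorem sum_eigenvalues_of_mem_spectraplex {X : Herm n} (hX : X ∈ spectraplex n) :
    ∑ k, X.isHermitian.eigenvalues k = 1 := by
  simpa [hX.2] using (congrArg Complex.re X.isHermitian.trace_eq_sum_eigenvalues).symm

theorem spectraplex_subset_spectrumIn : spectraplex n ⊆ spectrumIn n (Set.Icc 0 1) := by
  intro X hX
  have hnonneg : ∀ k, 0 ≤ X.isHermitian.eigenvalues k := hX.1.eigenvalues_nonneg
  refine mem_spectrumIn.2 fun k => ⟨hnonneg k, ?_⟩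
  rw [← sum_eigenvalues_of_mem_spectraplex hX]
  exact Finset.single_le_sum (fun j _ => hnonneg j) (Finset.mem_univ k)

theorem convex_spectraplex : Convex ℝ (spectraplex n) := by
  intro A hA B hB a b ha hb hab
  refine ⟨(hA.1.smul ha).add (hB.1.smul hb), ?_⟩
  rw [Herm.mat_add, Herm.mat_smul, Herm.mat_smul, Matrix.trace_add, Matrix.trace_smul,
    Matrix.trace_smul, hA.2, hB.2, ← add_smul, hab, one_smul]

theorem isClosed_spectraplex : IsClosed (spectraplex n) := by
  have hinter : spectraplex n = (⋂ x : Fin n → ℂ, {X : Herm n | 0 ≤ star x ⬝ᵥ X.mat *ᵥ x}) ∩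
      {X : Herm n | X.mat.trace = 1} := by
    ext X
    simp [spectraplex, Matrix.posSemidef_iff_dotProduct_mulVec, X.isHermitian]
  rw [hinter]
  refine (isClosed_iInter fun x => isClosed_le continuous_const ?_).inter
    (isClosed_eq continuous_mat.matrix_trace continuous_const)
  exact continuous_const.dotProduct (continuous_mat.matrix_mulVec continuous_const)

theorem norm_le_one_of_mem_spectraplex {X : Herm n} (hX : X ∈ spectraplex n) : ‖X‖ ≤ 1 := by
  refine (sq_le_one_iff₀ (norm_nonneg X)).1 ?_
  rw [← regularizer_sq, regularizer_eq_sum, ← sum_eigenvalues_of_mem_spectraplex hX]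
  refine Finset.sum_le_sum fun k _ => ?_
  have hk := mem_spectrumIn.1 (spectraplex_subset_spectrumIn hX) k
  exact pow_le_of_le_one hk.1 hk.2 two_ne_zero

theorem isCompact_spectraplex : IsCompact (spectraplex n) :=
  have : ProperSpace (Herm n) := FiniteDimensional.proper_real _
  Metric.isCompact_of_isClosed_isBounded isClosed_spectraplex <|
    isBounded_iff_forall_norm_le.2 ⟨1, fun _ => norm_le_one_of_mem_spectraplex⟩

theorem spectraplex_nonempty (hn : 0 < n) : (spectraplex n).Nonempty := by
  have hproj : (Matrix.diagonal (Pi.single (⟨0, hn⟩ : Fin n) (1 : ℂ))).PosSemidef :=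
    Matrix.PosSemidef.diagonal (Pi.single_nonneg.2 zero_le_one)
  exact ⟨Herm.ofIsHermitian _ hproj.isHermitian, hproj, by simp [Matrix.trace_diagonal]⟩

end Spectraplex

/-- Kernels of strongly convex regularizers. Compared with `IsRegularizerKernel`, only continuity
and the convexity consequence of the bound on the second derivative are kept. -/
structure IsStronglyConvexKernel (θ : ℝ → ℝ) : Prop where
  continuousOn : ContinuousOn θ (Set.Icc 0 1)
  strongConvexOn : ∃ m : ℝ, 0 < m ∧ StrongConvexOn (Set.Icc 0 1) m θ

theorem IsRegularizerKernel.isStronglyConvexKernel {θ : ℝ → ℝ} (hθ : IsRegularizerKernel θ) :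
    IsStronglyConvexKernel θ := by
  obtain ⟨m, hm, hle⟩ := hθ.second_deriv_lower_bound
  refine ⟨hθ.continuousOn, m, hm, strongConvexOn_iff_convex.2 ?_⟩
  simp only [Real.norm_eq_abs, sq_abs]
  have hnhds : ∀ x ∈ interior (Set.Icc (0 : ℝ) 1), Set.Ioc (0 : ℝ) 1 ∈ 𝓝 x := fun x hx => by
    rw [interior_Icc] at hx
    exact Ioc_mem_nhds hx.1 hx.2
  refine convexOn_of_hasDerivWithinAt2_nonneg (convex_Icc 0 1)
    (f' := fun x => derivWithin θ (Set.Ioc 0 1) x - m * x)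
    (f'' := fun x => derivWithin (derivWithin θ (Set.Ioc 0 1)) (Set.Ioc 0 1) x - m)
    (hθ.continuousOn.sub (by fun_prop)) (fun x hx => ?_) (fun x hx => ?_) fun x hx => ?_
  · have hderiv := (hθ.differentiableOn x (mem_of_mem_nhds (hnhds x hx))).hasDerivWithinAt
    have hsq := (hasDerivAt_pow 2 x).const_mul (m / 2)
    refine (((hderiv.hasDerivAt (hnhds x hx)).fun_sub hsq).congr_deriv ?_).hasDerivWithinAt
    norm_num
    ring
  · have hderiv := (hθ.differentiableOn_deriv x (mem_of_mem_nhds (hnhds x hx))).hasDerivWithinAt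
    have hlin := (hasDerivAt_id x).const_mul m
    simpa using ((hderiv.hasDerivAt (hnhds x hx)).fun_sub hlin).hasDerivWithinAt
  · exact sub_nonneg.2 (hle x (mem_of_mem_nhds (hnhds x hx)))

theorem norm_sub_le_of_isMaxOn_inner_sub {E : Type*} [NormedAddCommGroup E] [InnerProductSpace ℝ E]
    {s : Set E} {m : ℝ} {f : E → ℝ} (hm : 0 < m) (hf : StrongConvexOn s m f) {y y' x x' : E}
    (hxs : x ∈ s) (hxs' : x' ∈ s) (hx : IsMaxOn (fun z => inner ℝ y z - f z) s x)
    (hx' : IsMaxOn (fun z => inner ℝ y' z - f z) s x') : ‖x - x'‖ ≤ 2 / m * ‖y - y'‖ := by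
  have hhalf : (0 : ℝ) ≤ 1 / 2 := by norm_num
  have hmid := hf.2 hxs hxs' hhalf hhalf (add_halves 1)
  have hmem := hf.1 hxs hxs' hhalf hhalf (add_halves 1)
  have hle : inner ℝ y _ - f _ ≤ inner ℝ y x - f x := hx hmem
  have hle' : inner ℝ y' _ - f _ ≤ inner ℝ y' x' - f x' := hx' hmem
  simp only [inner_add_right, inner_smul_right, smul_eq_mul] at hmid hle hle'
  have hmono : m / 2 * ‖x - x'‖ * ‖x - x'‖ ≤ ‖y - y'‖ * ‖x - x'‖ := by
    refine le_trans ?_ (real_inner_le_norm (y - y') (x - x'))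
    simp only [inner_sub_left, inner_sub_right]
    linarith
  rcases (norm_nonneg (x - x')).eq_or_lt with h0 | hpos
  · rw [← h0]
    positivity
  · rw [div_mul_eq_mul_div, le_div_iff₀ hm]
    linarith [le_of_mul_le_mul_right hmono hpos]

section BestResponse

variable {n : ℕ} {θ : ℝ → ℝ}

theorem IsStronglyConvexKernel.exists_norm_sub_le (hθ : IsStronglyConvexKernel θ) (n : ℕ) :
    ∃ L : ℝ≥0, ∀ Y Y' X X' : Herm n, X ∈ regularizedBestResponse θ Y →
      X' ∈ regularizedBestResponse θ Y' → ‖X - X'‖ ≤ L * ‖Y - Y'‖ := by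
  obtain ⟨m, hm, hconv⟩ := hθ.strongConvexOn
  refine ⟨⟨2 / m, by positivity⟩, fun Y Y' X X' hX hX' => ?_⟩
  have hstrong : StrongConvexOn (spectraplex n) m (regularizer θ) :=
    strongConvexOn_iff_convex.2 <| (strongConvexOn_iff_convex.1 <|
      strongConvexOn_regularizer hconv).subset spectraplex_subset_spectrumIn convex_spectraplex
  exact norm_sub_le_of_isMaxOn_inner_sub hm hstrong hX.1 hX'.1 hX.2 hX'.2

theorem regularizedBestResponse_nonempty (hθ : ContinuousOn θ (Set.Icc 0 1)) (hn : 0 < n)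
    (Y : Herm n) : (regularizedBestResponse θ Y).Nonempty := by
  have hcont : ContinuousOn (fun X => Y.pairing X - regularizer θ X) (spectraplex n) :=
    (continuous_const.inner continuous_id (𝕜 := ℝ)).continuousOn.sub
      ((continuousOn_regularizer isCompact_Icc hθ).mono spectraplex_subset_spectrumIn)
  exact isCompact_spectraplex.exists_isMaxOn (spectraplex_nonempty hn) hcont

/-- A choice of a regularized best response to `Y`, with a junk value when there is none. It is a
function of the set of best responses only, so payoff matrices with the same best responses have
the same choice. -/
noncomputable def bestResponse (θ : ℝ → ℝ) (Y : Herm n) : Herm n :=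
  Classical.epsilon (· ∈ regularizedBestResponse θ Y)

theorem bestResponse_mem (hθ : ContinuousOn θ (Set.Icc 0 1)) (hn : 0 < n) (Y : Herm n) :
    bestResponse θ Y ∈ regularizedBestResponse θ Y :=
  Classical.epsilon_spec (regularizedBestResponse_nonempty hθ hn Y)

theorem IsStronglyConvexKernel.mem_regularizedBestResponse_iff (hθ : IsStronglyConvexKernel θ)
    (hn : 0 < n) {X Y : Herm n} : X ∈ regularizedBestResponse θ Y ↔ X = bestResponse θ Y := by
  have hmem := bestResponse_mem hθ.continuousOn hn Y
  refine ⟨fun hX => ?_, fun hX => hX ▸ hmem⟩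
  obtain ⟨L, hL⟩ := hθ.exists_norm_sub_le n
  simpa [sub_eq_zero] using hL Y Y X (bestResponse θ Y) hX hmem

theorem IsStronglyConvexKernel.exists_lipschitzWith_bestResponse (hθ : IsStronglyConvexKernel θ)
    (hn : 0 < n) : ∃ L : ℝ≥0, LipschitzWith L (bestResponse θ : Herm n → Herm n) := by
  obtain ⟨L, hL⟩ := hθ.exists_norm_sub_le n
  refine ⟨L, LipschitzWith.of_dist_le_mul fun Y Y' => ?_⟩
  rw [dist_eq_norm, dist_eq_norm]
  exact hL _ _ _ _ (bestResponse_mem hθ.continuousOn hn Y) (bestResponse_mem hθ.continuousOn hn Y')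

end BestResponse

/-! ### Payoff gradients -/

section Payoff

theorem contDiff_update_left {𝕜 ι : Type*} [NontriviallyNormedField 𝕜] [Fintype ι] [DecidableEq ι]
    {E : ι → Type*} [∀ i, NormedAddCommGroup (E i)] [∀ i, NormedSpace 𝕜 (E i)] {m : WithTop ℕ∞}
    (i : ι) (e : E i) : ContDiff 𝕜 m fun x : ∀ i, E i => Function.update x i e := by
  refine contDiff_pi.2 fun j => ?_
  rcases eq_or_ne j i with rfl | hj
  · simpa only [Function.update_self] using contDiff_const
  · simpa only [Function.update_of_ne hj] using! contDiff_pi.1 contDiff_id j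

variable {ι : Type*} [Fintype ι] [DecidableEq ι] {d : ι → ℕ} {Ω : Type*} [Fintype Ω]

theorem productMatrix_update_apply (X : ∀ i, Herm (d i)) (i : ι) (H : Herm (d i))
    (k l : ∀ i, Fin (d i)) :
    productMatrix (Function.update X i H) k l =
      H.mat (k i) (l i) * ∏ j ∈ Finset.univ.erase i, (X j).mat (k j) (l j) := by
  rw [productMatrix, Matrix.of_apply, ← Finset.mul_prod_erase _ _ (Finset.mem_univ i),
    Function.update_self]
  congr 1
  refine Finset.prod_congr rfl fun j hj => ?_
  rw [Function.update_of_ne (Finset.ne_of_mem_erase hj)]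

theorem continuous_mixedPayoff (G : QuantumGame d Ω) (i : ι) : Continuous (mixedPayoff G i) := by
  have hprod : Continuous (productMatrix : (∀ i, Herm (d i)) → _) :=
    continuous_matrix fun k l => continuous_finsetProd _ fun j _ =>
      (continuous_mat.comp (continuous_apply j)).matrix_elem (k j) (l j)
  refine continuous_finsetSum _ fun ω _ => Continuous.mul ?_ continuous_const
  exact Complex.continuous_re.comp (continuous_const.matrix_mul hprod).matrix_trace

/-- The expected payoff of player `i`, as a continuous multilinear map of the profile. -/
noncomputable def mixedPayoffMultilinear (G : QuantumGame d Ω) (i : ι) :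
    ContinuousMultilinearMap ℝ (fun j => Herm (d j)) ℝ where
  toFun := mixedPayoff G i
  map_update_add' X j A B := by
    have hadd : productMatrix (Function.update X j (A + B)) =
        productMatrix (Function.update X j A) + productMatrix (Function.update X j B) := by
      ext k l
      simp only [Matrix.add_apply, productMatrix_update_apply, Herm.mat_add, add_mul]
    simp [mixedPayoff, hadd, Matrix.mul_add, add_mul, Finset.sum_add_distrib]
  map_update_smul' X j r A := by
    have hsmul : productMatrix (Function.update X j (r • A)) =
        r • productMatrix (Function.update X j A) := by
      ext k l
      simp only [Matrix.smul_apply, productMatrix_update_apply, Herm.mat_smul, smul_mul_assoc]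
    simp [mixedPayoff, hsmul, mul_assoc, Finset.mul_sum]
  cont := continuous_mixedPayoff G i

theorem inner_payoffGradient (G : QuantumGame d Ω) (X : ∀ i, Herm (d i)) (i : ι) (H : Herm (d i)) :
    inner ℝ (payoffGradient G X i) H = mixedPayoff G i (Function.update X i H) := by
  have hderiv : fderiv ℝ (fun H : Herm (d i) => mixedPayoff G i (Function.update X i H)) (X i) =
      (mixedPayoffMultilinear G i).toContinuousLinearMap X i :=
    ((mixedPayoffMultilinear G i).toContinuousLinearMap X i).fderiv
  rw [payoffGradient, gradient, hderiv, InnerProductSpace.toDual_symm_apply]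
  rfl

theorem payoffGradient_update (G : QuantumGame d Ω) (X : ∀ i, Herm (d i)) (i : ι) (A : Herm (d i)) :
    payoffGradient G (Function.update X i A) i = payoffGradient G X i := by
  refine ext_inner_right ℝ fun H => ?_
  rw [inner_payoffGradient, inner_payoffGradient, Function.update_idem]

theorem payoffGradient_eq_sum {κ : Type*} [Fintype κ] (G : QuantumGame d Ω) (X : ∀ i, Herm (d i))
    (i : ι) (b : OrthonormalBasis κ ℝ (Herm (d i))) :
    payoffGradient G X i = ∑ a, mixedPayoff G i (Function.update X i (b a)) • b a := by
  conv_lhs => rw [← b.sum_repr' (payoffGradient G X i)]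
  simp only [real_inner_comm, inner_payoffGradient]

theorem contDiff_payoffGradient (G : QuantumGame d Ω) {m : WithTop ℕ∞} :
    ContDiff ℝ m (payoffGradient G) := by
  refine contDiff_pi.2 fun i => ?_
  simp only [payoffGradient_eq_sum G _ i (stdOrthonormalBasis ℝ (Herm (d i)))]
  refine ContDiff.sum fun a _ => ContDiff.smul_const ?_ _
  exact (mixedPayoffMultilinear G i).contDiff.comp (contDiff_update_left i _)

end Payoff

/-! ### The vector fields of the dynamics -/

section VectorField

variable {ι : Type*} [Fintype ι] [DecidableEq ι] {d : ι → ℕ} {Ω : Type*} [Fintype Ω]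

/-- The vector field `Y ↦ V(Q(Y))` of the FTQL dynamics. -/
noncomputable def ftqlField (G : QuantumGame d Ω) (θ : ι → ℝ → ℝ) (Y : ∀ i, Herm (d i)) :
    ∀ i, Herm (d i) :=
  payoffGradient G fun i => bestResponse (θ i) (Y i)

theorem isBoundedLipschitz_ftqlField (hd : ∀ i, 0 < d i) (G : QuantumGame d Ω) {θ : ι → ℝ → ℝ}
    (hθ : ∀ i, IsStronglyConvexKernel (θ i)) : IsBoundedLipschitz (ftqlField G θ) := by
  have hV := isBoundedLipschitz_domRestrict_of_contDiff (contDiff_payoffGradient G)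
    (convex_pi fun i _ => convex_spectraplex) (isCompact_univ_pi fun i => isCompact_spectraplex)
  obtain ⟨L, hL⟩ := exists_lipschitzWith_piMap fun i =>
    (hθ i).exists_lipschitzWith_bestResponse (hd i)
  have hmem : ∀ Y, Pi.map (fun i => bestResponse (θ i)) Y ∈
      Set.univ.pi fun i => spectraplex (d i) := fun Y i _ =>
    (bestResponse_mem (hθ i).continuousOn (hd i) (Y i)).1
  exact IsBoundedLipschitz.comp (g := fun Y => ⟨Pi.map _ Y, hmem Y⟩) hV (hL.subtype_mk hmem)

theorem ftqlField_update (G : QuantumGame d Ω) (θ : ι → ℝ → ℝ) (i : ι) (Y : ∀ i, Herm (d i))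
    (A : Herm (d i)) : ftqlField G θ (Function.update Y i A) i = ftqlField G θ Y i := by
  simp only [ftqlField, Function.apply_update fun j => bestResponse (θ j), payoffGradient_update]

theorem isFTQLSolution_iff_isIntegralCurve (hd : ∀ i, 0 < d i) (G : QuantumGame d Ω)
    {θ : ι → ℝ → ℝ} (hθ : ∀ i, IsStronglyConvexKernel (θ i)) (Y : ℝ → ∀ i, Herm (d i)) :
    IsFTQLSolution G θ Y ↔ IsIntegralCurve Y fun _ => ftqlField G θ := by
  simp only [IsFTQLSolution, (hθ _).mem_regularizedBestResponse_iff (hd _)]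
  simp only [← funext_iff, exists_eq_left]
  rfl

end VectorField

/-! ### The traceless quotient -/

section Traceless

variable {n : ℕ}

/-- `removeTrace` as a continuous linear map. -/
noncomputable def removeTraceCLM (n : ℕ) : Herm n →L[ℝ] Traceless n :=
  LinearMap.toContinuousLinearMap
    { toFun := removeTrace
      map_add' := fun A B => by
        refine Subtype.ext (Herm.ext ?_)
        change (A + B).mat - ((A + B).tr / n) • (1 : Matrix (Fin n) (Fin n) ℂ) =
          (A.mat - (A.tr / n) • (1 : Matrix (Fin n) (Fin n) ℂ)) +
            (B.mat - (B.tr / n) • (1 : Matrix (Fin n) (Fin n) ℂ))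
        simp only [Herm.mat_add, Herm.tr, Matrix.trace_add, Complex.add_re, add_div, add_smul]
        abel
      map_smul' := fun r A => by
        refine Subtype.ext (Herm.ext ?_)
        change (r • A).mat - ((r • A).tr / n) • (1 : Matrix (Fin n) (Fin n) ℂ) =
          r • (A.mat - (A.tr / n) • (1 : Matrix (Fin n) (Fin n) ℂ))
        simp only [Herm.mat_smul, Herm.tr, Matrix.trace_smul, Complex.smul_re, smul_eq_mul,
          smul_sub, smul_smul, mul_div_assoc] }

theorem lipschitzWith_toHerm : LipschitzWith 1 (Traceless.toHerm : Traceless n → Herm n) :=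
  LipschitzWith.subtype_val _

theorem pairing_removeTrace (Y : Herm n) {X : Herm n} (hX : X.mat.trace = 1) :
    (removeTrace Y).toHerm.pairing X = Y.pairing X - Y.tr / n := by
  change ((Y.mat - (Y.tr / n) • (1 : Matrix (Fin n) (Fin n) ℂ)) * X.mat).trace.re = _
  rw [sub_mul, smul_mul_assoc, one_mul, Matrix.trace_sub, Matrix.trace_smul, hX]
  simp [Herm.pairing]

theorem regularizedBestResponse_removeTrace (θ : ℝ → ℝ) (Y : Herm n) :
    regularizedBestResponse θ (removeTrace Y).toHerm = regularizedBestResponse θ Y := by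
  ext X
  refine and_congr_right fun hX => forall₂_congr fun X' hX' => ?_
  rw [pairing_removeTrace Y hX.2, pairing_removeTrace Y hX'.2, sub_right_comm,
    sub_right_comm _ (_ / _), sub_le_sub_iff_right]

theorem bestResponse_removeTrace (θ : ℝ → ℝ) (Y : Herm n) :
    bestResponse θ (removeTrace Y).toHerm = bestResponse θ Y := by
  simp only [bestResponse, regularizedBestResponse_removeTrace]

variable {ι : Type*} {d : ι → ℕ}

/-- The projection `Π` of profiles onto traceless profiles. -/
noncomputable def removeTracePi (d : ι → ℕ) : (∀ i, Herm (d i)) →L[ℝ] ∀ i, Traceless (d i) :=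
  ContinuousLinearMap.piMap fun i => removeTraceCLM (d i)

variable [Fintype ι] [DecidableEq ι] {Ω : Type*} [Fintype Ω]

/-- The vector field `Z ↦ Π(V(Q(Z)))` of the FTQL dynamics on traceless profiles. -/
noncomputable def tracelessField (G : QuantumGame d Ω) (θ : ι → ℝ → ℝ)
    (Z : ∀ i, Traceless (d i)) : ∀ i, Traceless (d i) :=
  removeTracePi d (ftqlField G θ fun i => (Z i).toHerm)

theorem isBoundedLipschitz_tracelessField (hd : ∀ i, 0 < d i) (G : QuantumGame d Ω)
    {θ : ι → ℝ → ℝ} (hθ : ∀ i, IsStronglyConvexKernel (θ i)) :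
    IsBoundedLipschitz (tracelessField G θ) := by
  obtain ⟨L, hL⟩ := exists_lipschitzWith_piMap fun i => ⟨1, lipschitzWith_toHerm (n := d i)⟩
  exact ((isBoundedLipschitz_ftqlField hd G hθ).comp hL).clm_comp (removeTracePi d)

theorem tracelessField_update (G : QuantumGame d Ω) (θ : ι → ℝ → ℝ) (i : ι)
    (Z : ∀ i, Traceless (d i)) (A : Traceless (d i)) :
    tracelessField G θ (Function.update Z i A) i = tracelessField G θ Z i := by
  have hcomm : (fun j => (Function.update Z i A j).toHerm) =
      Function.update (fun j => (Z j).toHerm) i A.toHerm :=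
    funext (Function.apply_update (fun _ => Traceless.toHerm) Z i A)
  rw [tracelessField, hcomm]
  exact congrArg removeTrace (ftqlField_update G θ i _ _)

theorem isTracelessFTQLSolution_iff_isIntegralCurve (hd : ∀ i, 0 < d i) (G : QuantumGame d Ω)
    {θ : ι → ℝ → ℝ} (hθ : ∀ i, IsStronglyConvexKernel (θ i)) (Z : ℝ → ∀ i, Traceless (d i)) :
    IsTracelessFTQLSolution G θ Z ↔ IsIntegralCurve Z fun _ => tracelessField G θ := by
  simp only [IsTracelessFTQLSolution, (hθ _).mem_regularizedBestResponse_iff (hd _)]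
  simp only [← funext_iff, exists_eq_left]
  rfl

theorem semiconj_removeTracePi (G : QuantumGame d Ω) (θ : ι → ℝ → ℝ) :
    Function.Semiconj (removeTracePi d) (ftqlField G θ) (tracelessField G θ) := fun Y => by
  refine congrArg (fun X => removeTracePi d (payoffGradient G X)) (funext fun i => ?_)
  exact (bestResponse_removeTrace (θ i) (Y i)).symm

end Traceless

end QuantumFTQL

theorem mainTheorem5_general {ι : Type*} [Fintype ι] [DecidableEq ι] (d : ι → ℕ)
    (hd : ∀ i, 0 < d i) {Ω : Type*} [Fintype Ω] (G : QuantumGame d Ω)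
    (θ : ι → ℝ → ℝ) (hθ : ∀ i, IsStronglyConvexKernel (θ i)) :
    (∃! φ : Flow ℝ (∀ i, Herm (d i)), IsFlowOf φ (IsFTQLSolution G θ)) ∧
    (∃! ζ : Flow ℝ (∀ i, Traceless (d i)), IsFlowOf ζ (IsTracelessFTQLSolution G θ)) ∧
    ∀ (φ : Flow ℝ (∀ i, Herm (d i))) (ζ : Flow ℝ (∀ i, Traceless (d i))),
      IsFlowOf φ (IsFTQLSolution G θ) →
      IsFlowOf ζ (IsTracelessFTQLSolution G θ) →
      (∀ (t : ℝ) (Y : ∀ i, Herm (d i)),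
        ζ t (fun i => removeTrace (Y i)) = fun i => removeTrace (φ t Y i)) ∧
      (∀ (U : Set (∀ i, Herm (d i))) (t : ℝ), volume (φ t '' U) = volume U) ∧
      (∀ (W : Set (∀ i, Traceless (d i))) (t : ℝ), volume (ζ t '' W) = volume W) := by
  have hF := isBoundedLipschitz_ftqlField hd G hθ
  have hF₀ := isBoundedLipschitz_tracelessField hd G hθ
  rw [funext fun Y => propext (isFTQLSolution_iff_isIntegralCurve hd G hθ Y),
    funext fun Z => propext (isTracelessFTQLSolution_iff_isIntegralCurve hd G hθ Z)]
  obtain ⟨φ, hφ⟩ := hF.exists_isFlowOf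
  obtain ⟨ζ, hζ⟩ := hF₀.exists_isFlowOf
  refine ⟨⟨φ, hφ, fun _ hφ' => hφ'.unique hφ⟩, ⟨ζ, hζ, fun _ hζ' => hζ'.unique hζ⟩,
    fun φ ζ hφ hζ => ⟨fun t Y => ?_, fun U t => ?_, fun W t => ?_⟩⟩
  · exact (flow_semiconj_of_map_field hφ hζ (removeTracePi d) (semiconj_removeTracePi G θ) t Y).symm
  · exact measure_image_flow (measurePreserving_flow_of_update hF (ftqlField_update G θ) hφ t) U
  · exact measure_image_flow
      (measurePreserving_flow_of_update hF₀ (tracelessField_update G θ) hζ t) W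

theorem mainTheorem5 {ι : Type*} [Fintype ι] [DecidableEq ι] (d : ι → ℕ) (hd : ∀ i, 0 < d i)
    {Ω : Type*} [Fintype Ω] (G : QuantumGame d Ω)
    (θ : ι → ℝ → ℝ) (hθ : ∀ i, IsRegularizerKernel (θ i)) :
    (∃! φ : Flow ℝ (∀ i, Herm (d i)),
      IsFlowOf φ (IsFTQLSolution G θ)) ∧
    (∃! ζ : Flow ℝ (∀ i, Traceless (d i)),
      IsFlowOf ζ (IsTracelessFTQLSolution G θ)) ∧
    ∀ (φ : Flow ℝ (∀ i, Herm (d i))) (ζ : Flow ℝ (∀ i, Traceless (d i))),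
      IsFlowOf φ (IsFTQLSolution G θ) →
      IsFlowOf ζ (IsTracelessFTQLSolution G θ) →
      (∀ (t : ℝ) (Y : ∀ i, Herm (d i)),
        ζ t (fun i => removeTrace (Y i)) =
          fun i => removeTrace (φ t Y i)) ∧
      (∀ U : Set (∀ i, Herm (d i)), IsOpen U → ∀ t : ℝ, 0 ≤ t →
        volume (φ t '' U) = volume U) ∧
      (∀ W : Set (∀ i, Traceless (d i)), IsOpen W → ∀ t : ℝ, 0 ≤ t →
        volume (ζ t '' W) = volume W) := by
  obtain ⟨hwp, hwp₀, h⟩ := mainTheorem5_general d hd G θ fun i => (hθ i).isStronglyConvexKernel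
  exact ⟨hwp, hwp₀, fun φ ζ hφ hζ => (h φ ζ hφ hζ).imp_right fun hvol =>
    ⟨fun U _ t _ => hvol.1 U t, fun W _ t _ => hvol.2 W t⟩⟩
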